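/- Let $k\ge 2$ and $m\ge 1$. The $k$-uniform hyperpath $P_m^{(k)}$ of length $m$ is the $k$-uniform hypergraph obtained from the path $P_m$ with $m$ edges (and $m+1$ vertices) by adding $k-2$ new vertices of degree one to each edge. Its adjacency tensor $\mathcal A=(a_{i_1\cdots i_k})$, indexed by the vertices, has $a_{i_1\cdots i_k}=\frac1{(k-1)!}$ if $\{i_1,\dots,i_k\}$ is an edge and $a_{i_1\cdots i_k}=0$ otherwise. A number $\lambda\in\mathbb C$ is an eigenvalue of $P_m^{(k)}$ if there is a nonzero complex vector $x$ with $\sum_{i_2,\dots,i_k}a_{i i_2\cdots i_k}x_{i_2}\cdots x_{i_k}=\lambda x_i^{k-1}$ for every vertex $i$. Put $$S=\Big\{\Big(2\cos\frac{\pi t}{j+2}\Big)^{2/k}e^{2\pi \mathbf i\theta/k}\ :\ j\in\{1,\dots,m\},\ t\in\{1,\dots,j+1\},\ \theta\in\{1,\dots,k\}\Big\},$$ where $\mathbf i^2=-1$ and the power $2/k$ is the principal complex power (with $0^{2/k}=0$). (1) If $k\ge 3$, the set of distinct eigenvalues of $P_m^{(k)}$ is $\{0\}\cup S$; if moreover $m\ge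 2$, then $0\in S$ and the set of distinct eigenvalues is exactly $S$. (2) For all $k\ge2$ and $m\ge1$, the spectral radius of $P_m^{(k)}$, that is, the largest modulus of an eigenvalue, is $\big(2\cos\frac{\pi}{m+2}\big)^{2/k}$. -/

import Mathlib

noncomputable section

/-- A complex tensor of order `k ≥ 1` whose indices run over `V`; the entry `t_{i₁ i₂ … i_k}` is
`T i₁ f`, where `f = (i₂, …, i_k)`. -/
abbrev ComplexTensor (k : ℕ) (V : Type*) : Type _ := V → (Fin (k - 1) → V) → ℂ

namespace ComplexTensor

variable {k : ℕ} {V : Type*} [Fintype V]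

/-- The vector `T x^{k-1}`, whose component at `i` is
`∑_{i₂, …, i_k} t_{i i₂ … i_k} x_{i₂} ⋯ x_{i_k}`. -/
def apply (T : ComplexTensor k V) (x : V → ℂ) (i : V) : ℂ :=
  ∑ f : Fin (k - 1) → V, T i f * ∏ j, x (f j)

/-- `lam` is an eigenvalue of `T`: there is a nonzero vector `x` with
`T x^{k-1} = lam x^{[k-1]}`. -/
def IsEigenvalue (T : ComplexTensor k V) (lam : ℂ) : Prop :=
  ∃ x : V → ℂ, x ≠ 0 ∧ ∀ i, T.apply x i = lam * x i ^ (k - 1)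

/-- The set of distinct eigenvalues of `T`. -/
def eigenvalues (T : ComplexTensor k V) : Set ℂ := {lam | T.IsEigenvalue lam}

/-- `r` is the spectral radius of `T`: the largest modulus of an eigenvalue of `T`. -/
def IsSpectralRadius (T : ComplexTensor k V) (r : ℝ) : Prop :=
  IsGreatest {s : ℝ | ∃ lam ∈ T.eigenvalues, s = ‖lam‖} r

end ComplexTensor

namespace Hypergraph

/-- A hypergraph is `k`-uniform if each of its edges contains exactly `k` distinct vertices. -/
def IsUniformOfCard {α : Type*} (H : Hypergraph α) (k : ℕ) : Prop :=
  ∀ e ∈ H.edgeSet, e.ncard = k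

open scoped Classical in
/-- The adjacency tensor of a `k`-uniform hypergraph `H`: the entry at `(i₁, …, i_k)` is
`1 / (k - 1)!` if `{i₁, …, i_k}` is an edge of `H`, and `0` otherwise. -/
def adjTensor {α : Type*} (H : Hypergraph α) (k : ℕ) : ComplexTensor k H.vertexSet :=
  fun i f =>
    if insert (i : α) (Set.range fun j => (f j : α)) ∈ H.edgeSet then
      1 / ((k - 1).factorial : ℂ)
    else 0

end Hypergraph

/-- The vertices of the `k`-uniform hyperpath of length `m`: the `m + 1` vertices of the path
`P_m`, and `k - 2` additional vertices for each of the `m` edges of the path. -/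
abbrev HyperpathVertex (k m : ℕ) : Type := Fin (m + 1) ⊕ (Fin m × Fin (k - 2))

/-- The `i`-th edge of the hyperpath: the two ends of the `i`-th edge of the path `P_m`, together
with the `k - 2` vertices that were added to this edge. -/
def hyperpathEdge (k m : ℕ) (i : Fin m) : Set (HyperpathVertex k m) :=
  {Sum.inl i.castSucc, Sum.inl i.succ} ∪ Set.range fun a : Fin (k - 2) => Sum.inr (i, a)

/-- The `k`-uniform hyperpath `P_m^{(k)}` of length `m` (for `2 ≤ k`). -/
def hyperpath (k m : ℕ) : Hypergraph (HyperpathVertex k m) where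
  vertexSet := Set.univ
  edgeSet := Set.range (hyperpathEdge k m)
  subset_vertexSet_of_mem_edgeSet' := fun _ _ => Set.subset_univ _

instance (k m : ℕ) : Fintype (hyperpath k m).vertexSet :=
  inferInstanceAs (Fintype (Set.univ : Set (HyperpathVertex k m)))

theorem hyperpath_isUniformOfCard {k : ℕ} (hk : 2 ≤ k) (m : ℕ) :
    (hyperpath k m).IsUniformOfCard k := by
  rintro _ ⟨i, rfl⟩
  have hinj : Function.Injective
      (fun a : Fin (k - 2) => (Sum.inr (i, a) : HyperpathVertex k m)) := by
    intro a b h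
    simpa using h
  have h1 : (Set.range fun a : Fin (k - 2) =>
      (Sum.inr (i, a) : HyperpathVertex k m)).ncard = k - 2 := by
    rw [← Set.image_univ, Set.ncard_image_of_injective _ hinj, Set.ncard_univ, Nat.card_fin]
  have h2 : ({Sum.inl i.castSucc, Sum.inl i.succ} : Set (HyperpathVertex k m)).ncard = 2 := by
    apply Set.ncard_pair
    intro h
    exact absurd (Sum.inl.inj h) (ne_of_lt Fin.castSucc_lt_succ)
  unfold hyperpathEdge
  rw [Set.ncard_union_eq ?_ (Set.toFinite _) (Set.toFinite _), h1, h2]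
  · omega
  · rw [Set.disjoint_left]
    rintro x hx ⟨a, rfl⟩
    simp at hx

/-- The distinct numbers `(2 cos (π t / (j + 2)))^{2/k} e^{2πiθ/k}` with `1 ≤ j ≤ m`,
`1 ≤ t ≤ j + 1` and `1 ≤ θ ≤ k`. The first factor is the principal value of the complex power. -/
def hyperpathNumbers (k m : ℕ) : Set ℂ :=
  {z | ∃ j ∈ Finset.Icc 1 m, ∃ t ∈ Finset.Icc 1 (j + 1), ∃ θ ∈ Finset.Icc 1 k,
    z = ((2 * Real.cos (Real.pi * t / (j + 2)) : ℝ) : ℂ) ^ ((2 : ℂ) / k) *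
      Complex.exp (2 * Real.pi * Complex.I * θ / k)}

end

/-! For an edge `e` let `X_e` be the product of the entries of an eigenvector `y` over `e`.
Multiplying the equation at `v` by `y v` says that the `X_e` with `v ∈ e` sum to `lam * y v ^ k`. If
`lam ≠ 0`, multiplying these relations over the vertices of an edge with `X_e ≠ 0` gives `lam ^ k *
X_e ^ 2 = (X_{e-1} + X_e) * (X_e + X_{e+1})`. A maximal run of `j` consecutive nonzero `X_e` is
bounded by zeros; with `μ ^ 2 = lam ^ k`, suitable square roots `z_i` of `X_{i-1} + X_i` form an
eigenvector, for `μ`, of the path with `j + 1` vertices. Chebyshev polynomials then give `μ = 2 cos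
(π t / (j + 2))` (`exists_eq_sq_of_edge_equations`).

Conversely, for `k ≥ 3` a sine eigenvector of a subpath, extended by zero, lifts to the hyperpath:
the added vertices let an edge vanish and let the phases of `k`-th roots be adjusted
(`hyperpath_isEigenvalue_of_pow_eq_sq`). The largest modulus comes from `j = m`, `t = 1`; for `k =
2` it is attained by the sine vector of the whole path. -/

/-! ### Path spectra and the edge equations -/

/-- The solutions `μ` of the eigenvalue problem `w_i + w_{i+2} = μ w_{i+1}` of the path with
`n` vertices. -/
theorem exists_eq_two_mul_cos_of_recurrence {n : ℕ} {μ : ℂ} {w : ℕ → ℂ}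
    (h0 : w 0 = 0) (h1 : w 1 ≠ 0) (hn : w (n + 1) = 0)
    (hrec : ∀ i < n, w i + w (i + 2) = μ * w (i + 1)) :
    ∃ t ∈ Finset.Icc 1 n, μ = ((2 * Real.cos (Real.pi * t / (n + 1)) : ℝ) : ℂ) := by
  have key : ∀ i : ℕ, i ≤ n →
      w i = w 1 * (Polynomial.Chebyshev.U ℂ ((i : ℤ) - 1)).eval (μ / 2) ∧
      w (i + 1) = w 1 * (Polynomial.Chebyshev.U ℂ i).eval (μ / 2) := by
    intro i
    induction i with
    | zero => intro _; simp [h0]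
    | succ i ih =>
      intro hi
      obtain ⟨ha, hb⟩ := ih (by omega)
      refine ⟨by simpa using hb, ?_⟩
      have h2 := Polynomial.Chebyshev.U_add_two ℂ ((i : ℤ) - 1)
      rw [show (i : ℤ) - 1 + 2 = ((i + 1 : ℕ) : ℤ) by push_cast; ring,
        show (i : ℤ) - 1 + 1 = i by ring] at h2
      have hr := hrec i (by omega)
      rw [h2]
      simp only [Polynomial.eval_sub, Polynomial.eval_mul, Polynomial.eval_ofNat,
        Polynomial.eval_X]
      rw [show i + 1 + 1 = i + 2 by rfl]
      linear_combination hr - ha + μ * hb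
  have hz : (Polynomial.Chebyshev.U ℂ n).IsRoot (μ / 2) := by
    have := (key n le_rfl).2
    rw [hn] at this
    exact (mul_eq_zero.mp this.symm).resolve_left h1
  -- `U_n` has `n` distinct real roots, so it splits over `ℝ` and has no further complex roots.
  have hcard : (Polynomial.Chebyshev.U ℝ n).roots.card =
      (Polynomial.Chebyshev.U ℝ n).natDegree := by
    rw [Polynomial.Chebyshev.roots_U_real, Polynomial.Chebyshev.natDegree_U_natCast,
      Finset.card_val, Finset.card_image_of_injOn]
    · simp
    · exact (Finset.range n).nodup_map_iff_injOn.mp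
        (Polynomial.Chebyshev.roots_U_real_nodup n)
  have hroots := (Polynomial.splits_iff_card_roots.mpr hcard).roots_map (algebraMap ℝ ℂ)
  rw [Polynomial.Chebyshev.map_U, Polynomial.Chebyshev.roots_U_real] at hroots
  have hne : Polynomial.Chebyshev.U ℂ n ≠ 0 := by
    intro h
    have := Polynomial.Chebyshev.degree_U_natCast ℂ n
    simp [h] at this
  have hmem := (Polynomial.mem_roots hne).mpr hz
  rw [hroots] at hmem
  simp only [Multiset.mem_map, Finset.mem_val, Finset.mem_image, Finset.mem_range] at hmem
  obtain ⟨_, ⟨s, hs, rfl⟩, h⟩ := hmem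
  refine ⟨s + 1, Finset.mem_Icc.mpr ⟨by omega, by omega⟩, ?_⟩
  have h' : μ = 2 * (algebraMap ℝ ℂ (Real.cos ((s + 1) * Real.pi / (n + 1)))) := by
    rw [h]; ring
  rw [h', mul_comm Real.pi]
  simp

/-- The edge equations of a hyperpath force the eigenvalue to come from a path. -/
theorem exists_eq_sq_of_edge_equations_of_ne_zero {j : ℕ} {c : ℂ} {Y : ℕ → ℂ}
    (hc : c ≠ 0) (h0 : Y 0 = 0) (hj : Y (j + 1) = 0) (hj0 : 1 ≤ j)
    (hne : ∀ i, 1 ≤ i → i ≤ j → Y i ≠ 0)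
    (hY : ∀ i < j, c * Y (i + 1) ^ 2 = (Y i + Y (i + 1)) * (Y (i + 1) + Y (i + 2))) :
    ∃ t ∈ Finset.Icc 1 (j + 1),
      c = ((2 * Real.cos (Real.pi * t / (j + 2)) : ℝ) : ℂ) ^ 2 := by
  obtain ⟨μ, hμ⟩ := IsAlgClosed.exists_pow_nat_eq c two_pos
  obtain ⟨s, hs⟩ := IsAlgClosed.exists_pow_nat_eq (Y 1) two_pos
  -- Choosing each square root separately would leave signs undetermined. This recursion fixes them
  -- so that `z i * z (i + 1) = μ * Y (i + 1)`.
  let z : ℕ → ℂ := fun i => Nat.rec s (fun i w => μ * Y (i + 1) / w) i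
  have hz0 : z 0 = s := rfl
  have hzs : ∀ i, z (i + 1) = μ * Y (i + 1) / z i := fun _ => rfl
  have hu : ∀ i ≤ j, Y i + Y (i + 1) ≠ 0 := by
    intro i hi
    rcases i with _ | i
    · simpa [h0] using hne 1 le_rfl hj0
    · have h1 : c * Y (i + 1) ^ 2 ≠ 0 :=
        mul_ne_zero hc (pow_ne_zero _ (hne _ (by omega) (by omega)))
      rw [hY i (by omega)] at h1
      exact right_ne_zero_of_mul h1
  have hz : ∀ i ≤ j, z i ^ 2 = Y i + Y (i + 1) := by
    intro i
    induction i with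
    | zero => intro _; rw [hz0, hs, h0, zero_add]
    | succ i ih =>
      intro hi
      have hui := hu i (by omega)
      rw [hzs, div_pow, mul_pow, hμ, ih (by omega), hY i (by omega)]
      field_simp
  have hzne : ∀ i ≤ j, z i ≠ 0 := fun i hi h => hu i hi (by rw [← hz i hi, h]; simp)
  have hprod : ∀ i ≤ j, z i * z (i + 1) = μ * Y (i + 1) := by
    intro i hi
    have := hzne i hi
    rw [hzs]
    field_simp
  -- `w` is `z` shifted by one behind a boundary zero; the other boundary value `z (j + 1)` vanishes
  -- with `Y (j + 1)`.
  obtain ⟨t, ht, h⟩ := exists_eq_two_mul_cos_of_recurrence (n := j + 1) (μ := μ)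
    (w := fun i => Nat.casesOn i 0 z) rfl (hzne 0 (by omega)) (by simp [hzs, hj]) (by
      intro i hi
      have h1 := hzne i (by omega)
      have h2 := hprod i (by omega)
      have h3 := hz i (by omega)
      apply mul_left_cancel₀ h1
      rcases i with _ | i
      · rw [h0] at h3
        show z 0 * (0 + z (0 + 1)) = z 0 * (μ * z 0)
        linear_combination h2 - μ * h3
      · have h4 := hprod i (by omega)
        show z (i + 1) * (z i + z (i + 1 + 1)) = z (i + 1) * (μ * z (i + 1))
        linear_combination h4 + h2 - μ * h3)
  refine ⟨t, ht, ?_⟩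
  rw [← hμ, h]
  congr 4
  push_cast
  ring

/-- The run of nonzero values that starts at the first nonzero `X i` has zeros on both sides, and
its length is the `j` of the conclusion. -/
theorem exists_eq_sq_of_edge_equations {m : ℕ} {c : ℂ} {X : ℕ → ℂ}
    (hc : c ≠ 0) (h0 : X 0 = 0) (hm : ∀ i, m < i → X i = 0) (hne : ∃ i, X i ≠ 0)
    (hX : ∀ i, X (i + 1) ≠ 0 →
      c * X (i + 1) ^ 2 = (X i + X (i + 1)) * (X (i + 1) + X (i + 2))) :
    ∃ j ∈ Finset.Icc 1 m, ∃ t ∈ Finset.Icc 1 (j + 1),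
      c = ((2 * Real.cos (Real.pi * t / (j + 2)) : ℝ) : ℂ) ^ 2 := by
  classical
  have ha := Nat.find_spec hne
  have ha' : ∀ i < Nat.find hne, X i = 0 := fun i hi => not_not.mp (Nat.find_min hne hi)
  generalize Nat.find hne = a at ha ha'
  obtain ⟨a, rfl⟩ : ∃ b, a = b + 1 := Nat.exists_eq_succ_of_ne_zero (by rintro rfl; exact ha h0)
  have ham : a + 1 ≤ m := by
    by_contra h
    exact ha (hm _ (by omega))
  have hex : ∃ d, X (a + 1 + (d + 1)) = 0 := ⟨m, hm _ (by omega)⟩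
  have hd := Nat.find_spec hex
  have hd' : ∀ i < Nat.find hex, X (a + 1 + (i + 1)) ≠ 0 := fun i hi => Nat.find_min hex hi
  generalize Nat.find hex = d at hd hd'
  have hne' : ∀ i, 1 ≤ i → i ≤ d + 1 → X (a + i) ≠ 0 := by
    intro i h1 h2
    obtain ⟨i, rfl⟩ : ∃ b, i = b + 1 := ⟨i - 1, by omega⟩
    rcases i with _ | i
    · exact ha
    · have := hd' i (by omega)
      rwa [show a + 1 + (i + 1) = a + (i + 1 + 1) by ring] at this
  have hdm : a + (d + 1) ≤ m := by
    by_contra h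
    exact hne' (d + 1) (by omega) le_rfl (hm _ (by omega))
  obtain ⟨t, ht, h⟩ := exists_eq_sq_of_edge_equations_of_ne_zero (j := d + 1)
    (Y := fun i => X (a + i)) hc
    (ha' a (by omega)) (by rw [← hd]; congr 1; ring) (by omega) hne'
    (fun i hi => hX (a + i) (hne' (i + 1) (by omega) (by omega)))
  exact ⟨d + 1, Finset.mem_Icc.mpr ⟨by omega, by omega⟩, t, ht, h⟩

/-! ### The adjacency tensor as a sum over edges -/

/-- The tuples with image `A` are the bijections onto `A`. Their number cancels the factor `1 / (k -
1)!` of the adjacency tensor. -/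
theorem sum_prod_of_image_eq {α : Type*} [Fintype α] [DecidableEq α] (x : α → ℂ)
    (A : Finset α) :
    (∑ f : Fin A.card → α with Finset.univ.image f = A, ∏ j, x (f j)) =
      (A.card.factorial : ℂ) * ∏ v ∈ A, x v := by
  have hinj : ∀ f : Fin A.card → α, Finset.univ.image f = A → Function.Injective f := by
    intro f hf
    have h : (Finset.univ.image f).card = (Finset.univ : Finset (Fin A.card)).card := by simp [hf]
    exact Set.injOn_univ.mp (by simpa using Finset.card_image_iff.mp h)
  have hcard : (Finset.univ.filter fun f : Fin A.card → α => Finset.univ.image f = A).card =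
      A.card.factorial := by
    have : Fintype.card (Fin A.card ≃ A) = A.card.factorial := by
      rw [Fintype.card_equiv A.equivFin.symm, Fintype.card_fin]
    rw [← this, ← Finset.card_univ]
    symm
    refine Finset.card_bij (fun e _ j => (e j : α)) ?_ ?_ ?_
    · intro e _
      simp only [Finset.mem_filter, Finset.mem_univ, true_and]
      ext v
      simp only [Finset.mem_image, Finset.mem_univ, true_and]
      exact ⟨by rintro ⟨j, rfl⟩; exact (e j).2, fun hv => ⟨e.symm ⟨v, hv⟩, by simp⟩⟩
    · intro e _ e' _ h
      ext j
      exact congrFun h j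
    · intro f hf
      simp only [Finset.mem_filter, Finset.mem_univ, true_and] at hf
      have hm : ∀ j, f j ∈ A := fun j => hf ▸ Finset.mem_image_of_mem f (Finset.mem_univ j)
      refine ⟨Equiv.ofBijective (fun j => (⟨f j, hm j⟩ : A))
        ((Fintype.bijective_iff_injective_and_card _).mpr ⟨?_, by simp⟩), Finset.mem_univ _, rfl⟩
      intro a b h
      exact hinj f hf (congrArg Subtype.val h)
  rw [← hcard, ← nsmul_eq_mul]
  apply Finset.sum_eq_card_nsmul
  intro f hf
  simp only [Finset.mem_filter, Finset.mem_univ, true_and] at hf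
  conv_rhs => rw [← hf]
  rw [Finset.prod_image fun a _ b _ h => hinj f hf h]

/-- The `i`-th edge of the hyperpath as a finite set. -/
def hyperpathEdgeFinset (k m : ℕ) (i : Fin m) : Finset (HyperpathVertex k m) :=
  Finset.disjSum {i.castSucc, i.succ} ({i} ×ˢ Finset.univ)

section

variable {k m : ℕ}

theorem inl_mem_hyperpathEdgeFinset {i : Fin m} {p : Fin (m + 1)} :
    Sum.inl p ∈ hyperpathEdgeFinset k m i ↔ p = i.castSucc ∨ p = i.succ := by
  simp [hyperpathEdgeFinset]

theorem inr_mem_hyperpathEdgeFinset {i e : Fin m} {a : Fin (k - 2)} :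
    Sum.inr (e, a) ∈ hyperpathEdgeFinset k m i ↔ e = i := by
  simp [hyperpathEdgeFinset, eq_comm]

theorem coe_hyperpathEdgeFinset (i : Fin m) :
    (hyperpathEdgeFinset k m i : Set (HyperpathVertex k m)) = hyperpathEdge k m i := by
  ext v
  rcases v with p | ⟨e, a⟩
  · simp [inl_mem_hyperpathEdgeFinset, hyperpathEdge]
  · simp [inr_mem_hyperpathEdgeFinset, hyperpathEdge, eq_comm]

theorem card_hyperpathEdgeFinset (hk : 2 ≤ k) (i : Fin m) :
    (hyperpathEdgeFinset k m i).card = k := by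
  rw [hyperpathEdgeFinset, Finset.card_disjSum, Finset.card_pair Fin.castSucc_lt_succ.ne]
  simp
  omega

theorem prod_hyperpathEdgeFinset (i : Fin m) (x : HyperpathVertex k m → ℂ) :
    ∏ v ∈ hyperpathEdgeFinset k m i, x v =
      x (Sum.inl i.castSucc) * x (Sum.inl i.succ) * ∏ a, x (Sum.inr (i, a)) := by
  rw [hyperpathEdgeFinset, Finset.prod_disjSum, Finset.prod_pair Fin.castSucc_lt_succ.ne]
  simp

theorem hyperpathEdgeFinset_injective : Function.Injective (hyperpathEdgeFinset k m) := by
  intro i j h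
  have h1 : Sum.inl i.castSucc ∈ hyperpathEdgeFinset k m j := by
    rw [← h]; simp [inl_mem_hyperpathEdgeFinset]
  have h2 : Sum.inl j.castSucc ∈ hyperpathEdgeFinset k m i := by
    rw [h]; simp [inl_mem_hyperpathEdgeFinset]
  simp only [inl_mem_hyperpathEdgeFinset, Fin.ext_iff, Fin.val_castSucc, Fin.val_succ] at h1 h2
  ext
  omega

theorem hyperpath_adjTensor_apply (hk : 2 ≤ k) (y : HyperpathVertex k m → ℂ)
    (v : (hyperpath k m).vertexSet) :
    ((hyperpath k m).adjTensor k).apply (fun w => y w) v =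
      ∑ i with (v : HyperpathVertex k m) ∈ hyperpathEdgeFinset k m i,
        ∏ w ∈ (hyperpathEdgeFinset k m i).erase v, y w := by
  classical
  obtain ⟨v, hv⟩ := v
  let φ : (hyperpath k m).vertexSet ≃ HyperpathVertex k m := Equiv.Set.univ _
  have h1 : ((hyperpath k m).adjTensor k).apply (fun w => y w) ⟨v, hv⟩ =
      ∑ f : Fin (k - 1) → HyperpathVertex k m,
        (if insert v (Set.range f) ∈ Set.range (hyperpathEdge k m) then
          1 / ((k - 1).factorial : ℂ) else 0) * ∏ j, y (f j) := by
    unfold ComplexTensor.apply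
    exact Fintype.sum_equiv (Equiv.arrowCongr (Equiv.refl _) φ) _ _ fun f =>
      congrArg₂ (· * ·) (if_congr Iff.rfl rfl rfl) rfl
  have h2 : ∀ f : Fin (k - 1) → HyperpathVertex k m,
      (if insert v (Set.range f) ∈ Set.range (hyperpathEdge k m) then
          1 / ((k - 1).factorial : ℂ) else 0) * ∏ j, y (f j) =
        ∑ i, if v ∈ hyperpathEdgeFinset k m i ∧
            Finset.univ.image f = (hyperpathEdgeFinset k m i).erase v then
          1 / ((k - 1).factorial : ℂ) * ∏ j, y (f j) else 0 := by
    intro f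
    have hiff : ∀ i, (v ∈ hyperpathEdgeFinset k m i ∧
        Finset.univ.image f = (hyperpathEdgeFinset k m i).erase v) ↔
        insert v (Finset.univ.image f) = hyperpathEdgeFinset k m i := by
      intro i
      constructor
      · rintro ⟨h, h'⟩
        rw [h', Finset.insert_erase h]
      · intro h
        refine ⟨h ▸ Finset.mem_insert_self _ _, ?_⟩
        rw [← h, Finset.erase_insert]
        -- If `v` were a value of `f`, the edge would have at most `k - 1` elements.
        intro hmem
        rw [Finset.insert_eq_of_mem hmem] at h
        have hc := (Finset.card_image_le (s := Finset.univ) (f := f))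
        rw [h, card_hyperpathEdgeFinset hk, Finset.card_univ, Fintype.card_fin] at hc
        omega
    have hset : insert v (Set.range f) ∈ Set.range (hyperpathEdge k m) ↔
        ∃ i, insert v (Finset.univ.image f) = hyperpathEdgeFinset k m i := by
      simp only [Set.mem_range, ← coe_hyperpathEdgeFinset, ← Finset.coe_inj]
      simp [eq_comm]
    simp only [hiff, hset]
    split_ifs with h
    · obtain ⟨i, hi⟩ := h
      rw [hi]
      simp [hyperpathEdgeFinset_injective.eq_iff]
    · push Not at h
      simp [h]
  rw [h1, Finset.sum_congr rfl fun f _ => h2 f, Finset.sum_comm, Finset.sum_filter]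
  refine Finset.sum_congr rfl fun i _ => ?_
  by_cases hvi : v ∈ hyperpathEdgeFinset k m i
  · have hcard : ((hyperpathEdgeFinset k m i).erase v).card = k - 1 := by
      rw [Finset.card_erase_of_mem hvi, card_hyperpathEdgeFinset hk]
    have h3 := sum_prod_of_image_eq y ((hyperpathEdgeFinset k m i).erase v)
    rw [hcard] at h3
    simp only [hvi, true_and, if_true]
    rw [← Finset.sum_filter, ← Finset.mul_sum, h3, ← mul_assoc, one_div,
      inv_mul_cancel₀ (by exact_mod_cast Nat.factorial_ne_zero _), one_mul]
  · simp [hvi]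

theorem hyperpath_isEigenvalue_iff (hk : 2 ≤ k) (lam : ℂ) :
    ((hyperpath k m).adjTensor k).IsEigenvalue lam ↔
      ∃ y : HyperpathVertex k m → ℂ, y ≠ 0 ∧ ∀ v,
        ∑ i with v ∈ hyperpathEdgeFinset k m i,
          ∏ w ∈ (hyperpathEdgeFinset k m i).erase v, y w = lam * y v ^ (k - 1) := by
  constructor
  · rintro ⟨x, hx, h⟩
    refine ⟨fun v => x ⟨v, trivial⟩, ?_, fun v => ?_⟩
    · intro h0
      exact hx (funext fun v => congrFun h0 v)
    · rw [← h ⟨v, trivial⟩, ← hyperpath_adjTensor_apply hk _ ⟨v, trivial⟩]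
  · rintro ⟨y, hy, h⟩
    refine ⟨fun v => y v, ?_, fun v => ?_⟩
    · intro h0
      exact hy (funext fun v => congrFun h0 ⟨v, trivial⟩)
    · rw [hyperpath_adjTensor_apply hk, h]

theorem mul_sum_prod_erase (y : HyperpathVertex k m → ℂ) (v : HyperpathVertex k m) :
    y v * ∑ i with v ∈ hyperpathEdgeFinset k m i,
      ∏ w ∈ (hyperpathEdgeFinset k m i).erase v, y w =
    ∑ i with v ∈ hyperpathEdgeFinset k m i, ∏ w ∈ hyperpathEdgeFinset k m i, y w := by
  rw [Finset.mul_sum]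
  refine Finset.sum_congr rfl fun i hi => ?_
  exact Finset.mul_prod_erase _ _ (Finset.mem_filter.mp hi).2

end

/-! ### Edge products and the construction of eigenvectors -/

section

variable {k m : ℕ}

/-- The sequence `0, X_0, …, X_{m-1}, 0, 0, …`. -/
def padSeq (X : Fin m → ℂ) : ℕ → ℂ
  | 0 => 0
  | i + 1 => if h : i < m then X ⟨i, h⟩ else 0

theorem padSeq_succ_of_lt (X : Fin m → ℂ) {i : ℕ} (h : i < m) :
    padSeq X (i + 1) = X ⟨i, h⟩ := dif_pos h

theorem padSeq_of_lt (X : Fin m → ℂ) {i : ℕ} (h : m < i) : padSeq X i = 0 := by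
  obtain ⟨i, rfl⟩ : ∃ b, i = b + 1 := ⟨i - 1, by omega⟩
  exact dif_neg (by omega)

/-- The path vertex `p` lies on the edges `p - 1` and `p`, stored in `padSeq` at `p` and `p + 1`;
the padding supplies zeros at the two ends of the path. -/
theorem sum_inl_mem_hyperpathEdgeFinset (X : Fin m → ℂ) (p : Fin (m + 1)) :
    ∑ i with Sum.inl p ∈ hyperpathEdgeFinset k m i, X i =
      padSeq X p + padSeq X (p + 1) := by
  have h : ∀ i : Fin m, (if Sum.inl p ∈ hyperpathEdgeFinset k m i then X i else 0) =
      (if (p : ℕ) = i + 1 then X i else 0) + (if (p : ℕ) = i then X i else 0) := by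
    intro i
    simp only [inl_mem_hyperpathEdgeFinset, Fin.ext_iff, Fin.val_castSucc, Fin.val_succ]
    by_cases h1 : (p : ℕ) = i
    · simp [h1]
    · simp [h1]
  have aux : ∀ q : ℕ, ∑ i : Fin m, (if q = i then X i else 0) = padSeq X (q + 1) := by
    intro q
    by_cases hq : q < m
    · rw [padSeq_succ_of_lt X hq, Finset.sum_eq_single ⟨q, hq⟩]
      · simp
      · intro i _ hi
        rw [if_neg]
        rintro rfl
        exact hi rfl
      · simp
    · rw [padSeq_of_lt X (by omega)]
      exact Finset.sum_eq_zero fun i _ => if_neg (by omega)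
  rw [Finset.sum_filter, Finset.sum_congr rfl fun i _ => h i, Finset.sum_add_distrib, aux]
  congr 1
  obtain ⟨p, hp⟩ := p
  rcases p with _ | q
  · simp [padSeq]
  · simp only [Nat.add_right_cancel_iff]
    exact aux q

theorem sum_inr_mem_hyperpathEdgeFinset (X : Fin m → ℂ) (e : Fin m) (a : Fin (k - 2)) :
    ∑ i with Sum.inr (e, a) ∈ hyperpathEdgeFinset k m i, X i = X e := by
  simp [inr_mem_hyperpathEdgeFinset, Finset.sum_filter]

theorem pow_eq_sq_of_hyperpath_isEigenvalue (hk : 2 ≤ k) {lam : ℂ} (hlam : lam ≠ 0)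
    (h : ((hyperpath k m).adjTensor k).IsEigenvalue lam) :
    ∃ j ∈ Finset.Icc 1 m, ∃ t ∈ Finset.Icc 1 (j + 1),
      lam ^ k = ((2 * Real.cos (Real.pi * t / (j + 2)) : ℝ) : ℂ) ^ 2 := by
  obtain ⟨y, hy, h⟩ := (hyperpath_isEigenvalue_iff hk lam).mp h
  let X : Fin m → ℂ := fun i => ∏ w ∈ hyperpathEdgeFinset k m i, y w
  have hk1 : k - 1 + 1 = k := by omega
  have hmul : ∀ v, ∑ i with v ∈ hyperpathEdgeFinset k m i, X i = lam * y v ^ k := by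
    intro v
    rw [← mul_sum_prod_erase, h v, mul_left_comm, ← pow_succ', hk1]
  have hp : ∀ p : Fin (m + 1), padSeq X p + padSeq X (p + 1) = lam * y (Sum.inl p) ^ k :=
    fun p => by rw [← hmul, sum_inl_mem_hyperpathEdgeFinset]
  have hq : ∀ e a, X e = lam * y (Sum.inr (e, a)) ^ k :=
    fun e a => by rw [← hmul, sum_inr_mem_hyperpathEdgeFinset]
  refine exists_eq_sq_of_edge_equations (X := padSeq X) (pow_ne_zero k hlam) rfl
    (fun i hi => padSeq_of_lt X hi) ?_ ?_
  · by_contra! hall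
    have hX : ∀ e, X e = 0 := fun e => by
      rw [← padSeq_succ_of_lt X e.2]; exact hall _
    apply hy
    funext v
    have := hmul v
    simp only [hX, Finset.sum_const_zero] at this
    exact pow_eq_zero_iff (by omega) |>.mp ((mul_eq_zero.mp this.symm).resolve_left hlam)
  · intro i hi
    have him : i < m := by
      by_contra hc
      exact hi (padSeq_of_lt X (by omega))
    have hXi := padSeq_succ_of_lt X him
    rw [hXi] at hi
    have h1 := hp (Fin.castSucc ⟨i, him⟩)
    have h2 := hp (Fin.succ ⟨i, him⟩)
    simp only [Fin.val_castSucc, Fin.val_succ] at h1 h2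
    rw [h1, h2, hXi]
    have hprod : X ⟨i, him⟩ = _ := prod_hyperpathEdgeFinset ⟨i, him⟩ y
    have h3 : lam ^ (k - 2) * ∏ a, y (Sum.inr (⟨i, him⟩, a)) ^ k = X ⟨i, him⟩ ^ (k - 2) := by
      have : ∏ a : Fin (k - 2), (lam * y (Sum.inr (⟨i, him⟩, a)) ^ k) =
          ∏ a : Fin (k - 2), X ⟨i, him⟩ := Finset.prod_congr rfl fun a _ => (hq _ a).symm
      simpa [Finset.prod_mul_distrib] using this
    -- Each of the `k - 2` added vertices contributes one factor `X_e`, so the equation is compared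
    -- with `X_e ^ k`.
    apply mul_right_cancel₀ (pow_ne_zero (k - 2) hi)
    have e1 : X ⟨i, him⟩ ^ 2 * X ⟨i, him⟩ ^ (k - 2) = X ⟨i, him⟩ ^ k := by
      rw [← pow_add]; congr 1; omega
    have e2 : lam ^ k = lam ^ 2 * lam ^ (k - 2) := by
      rw [← pow_add]; congr 1; omega
    rw [mul_assoc, e1, ← h3, e2]
    conv_lhs => rw [hprod]
    rw [mul_pow, mul_pow, Finset.prod_pow]
    ring

/-- All `g a` but one are a fixed `k`-th root `r` of `Y`; the remaining one absorbs the phase needed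
for the product. -/
theorem exists_prod_eq_of_pow_eq {n : ℕ} (hn : 1 ≤ n) (hk : 1 ≤ k) {P Y : ℂ}
    (h : P ^ k = Y ^ n) : ∃ g : Fin n → ℂ, (∀ a, g a ^ k = Y) ∧ ∏ a, g a = P := by
  obtain ⟨n, rfl⟩ : ∃ b, n = b + 1 := ⟨n - 1, by omega⟩
  obtain ⟨r, hr⟩ := IsAlgClosed.exists_pow_nat_eq Y hk
  have hk0 : k ≠ 0 := by omega
  by_cases hY : Y = 0
  · subst hY
    have hP : P = 0 := by simpa [hk0] using h
    exact ⟨fun _ => 0, fun _ => by simp [hk0], by simp [hP]⟩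
  · have hr0 : r ≠ 0 := by rintro rfl; exact hY (by rw [← hr]; simp [hk0])
    refine ⟨Fin.cons (P / r ^ n) fun _ => r, fun a => ?_, ?_⟩
    · refine Fin.cases ?_ (fun _ => hr) a
      rw [Fin.cons_zero, div_pow, h, ← pow_mul, mul_comm n, pow_mul, hr]
      field_simp
      ring
    · rw [Fin.prod_univ_succ]
      simp
      field_simp

/-- The factor `z i` in `hrec` imposes the path equation only where `z i ≠ 0`, so a subpath
eigenvector extended by zero is admissible. The lift has edge products `z i * z (i + 1) / μ`. -/
theorem hyperpath_isEigenvalue_of_pow_eq_sq (hk : 3 ≤ k) {lam μ : ℂ} (hlam : lam ≠ 0)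
    (hμ : lam ^ k = μ ^ 2) {z : ℕ → ℂ} (hz : ∃ i ≤ m, z i ≠ 0)
    (hrec : ∀ i ≤ m, z i * (μ * z i) =
      z i * ((if i = 0 then 0 else z (i - 1)) + if i = m then 0 else z (i + 1))) :
    ((hyperpath k m).adjTensor k).IsEigenvalue lam := by
  rw [hyperpath_isEigenvalue_iff (by omega)]
  have hk0 : k ≠ 0 := by omega
  have hμ0 : μ ≠ 0 := by
    rintro rfl
    exact pow_ne_zero k hlam (by simpa using hμ)
  have hroot : ∀ i, ∃ r : ℂ, r ^ k = z i ^ 2 / lam := fun i =>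
    IsAlgClosed.exists_pow_nat_eq _ (by omega)
  choose r hr using hroot
  have hr0 : ∀ i, r i = 0 ↔ z i = 0 := by
    intro i
    rw [← pow_eq_zero_iff hk0, hr]
    simp [hlam]
  have hpend : ∀ i, ∃ g : Fin (k - 2) → ℂ, (∀ a, g a ^ k = z i * z (i + 1) / μ / lam) ∧
      r i * r (i + 1) * ∏ a, g a = z i * z (i + 1) / μ := by
    intro i
    by_cases h0 : z i * z (i + 1) = 0
    · refine ⟨fun _ => 0, fun _ => by simp [h0, hk0], ?_⟩
      have : r i * r (i + 1) = 0 := by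
        rw [mul_eq_zero] at h0 ⊢
        rwa [hr0, hr0]
      rw [this, h0]
      simp
    · have hz1 := left_ne_zero_of_mul h0
      have hz2 := right_ne_zero_of_mul h0
      have hr1 : r i ≠ 0 := (hr0 i).not.mpr hz1
      have hr2 : r (i + 1) ≠ 0 := (hr0 _).not.mpr hz2
      obtain ⟨g, hg, hg'⟩ := exists_prod_eq_of_pow_eq (n := k - 2) (k := k)
        (P := z i * z (i + 1) / μ / (r i * r (i + 1))) (Y := z i * z (i + 1) / μ / lam)
        (by omega) (by omega) (by
          have e : ∀ w : ℂ, w ^ k = w ^ (k - 2) * w ^ 2 := fun w => by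
            rw [← pow_add]; congr 1; omega
          rw [div_pow _ (r i * r (i + 1)), mul_pow (r i), hr, hr, div_pow _ lam]
          rw [e (z i * z (i + 1) / μ)]
          have e2 : lam ^ (k - 2) * lam ^ 2 = μ ^ 2 := by rw [← e, hμ]
          generalize (z i * z (i + 1) / μ) ^ (k - 2) = B
          field_simp
          rw [← e2]
          ring)
      refine ⟨g, hg, ?_⟩
      rw [hg']
      field_simp
  choose g hg hg' using hpend
  let y : HyperpathVertex k m → ℂ := Sum.elim (fun p => r p) fun q => g q.1 q.2
  let X : Fin m → ℂ := fun i => z i * z (i + 1) / μ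
  have hX : ∀ i, ∏ w ∈ hyperpathEdgeFinset k m i, y w = X i := by
    intro i
    rw [prod_hyperpathEdgeFinset]
    simpa [y, X] using hg' i
  have hzero : ∀ i, X i = 0 → ∀ a, y (Sum.inr (i, a)) = 0 := by
    intro i hi a
    rw [← pow_eq_zero_iff hk0]
    show g i a ^ k = 0
    rw [hg]
    change z i * z (i + 1) / μ = 0 at hi
    rw [hi, zero_div]
  refine ⟨y, ?_, ?_⟩
  · obtain ⟨i, hi, hzi⟩ := hz
    intro h
    exact (hr0 i).not.mpr hzi (congrFun h (Sum.inl ⟨i, by omega⟩))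
  intro v
  -- Multiplying by `y v` loses information when it is zero. There each edge through `v` must keep
  -- another zero after `v` is erased: an added vertex if `v` is on the path, an end of the edge
  -- otherwise.
  by_cases hv : y v = 0
  · rw [hv, zero_pow (by omega), mul_zero]
    refine Finset.sum_eq_zero fun i hi => ?_
    have hvi := (Finset.mem_filter.mp hi).2
    rcases v with p | ⟨e, a⟩
    · have hXi : X i = 0 := by
        rw [← hX]
        exact Finset.prod_eq_zero hvi hv
      refine Finset.prod_eq_zero (i := Sum.inr (i, ⟨0, by omega⟩)) ?_ (hzero i hXi _)
      simp [inr_mem_hyperpathEdgeFinset]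
    · obtain rfl : e = i := inr_mem_hyperpathEdgeFinset.mp hvi
      have hXi : X e = 0 := by
        rw [← hX]
        exact Finset.prod_eq_zero hvi hv
      have hzz : z e = 0 ∨ z (e + 1) = 0 := by
        simpa [X, hμ0] using hXi
      rcases hzz with h | h
      · refine Finset.prod_eq_zero (i := Sum.inl e.castSucc) ?_ ((hr0 e).mpr h)
        simp [inl_mem_hyperpathEdgeFinset]
      · refine Finset.prod_eq_zero (i := Sum.inl e.succ) ?_ ((hr0 (e + 1)).mpr h)
        simp [inl_mem_hyperpathEdgeFinset]
  · apply mul_left_cancel₀ hv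
    rw [mul_sum_prod_erase, Finset.sum_congr rfl fun i _ => hX i, mul_left_comm, ← pow_succ',
      show k - 1 + 1 = k by omega]
    rcases v with p | ⟨e, a⟩
    · rw [sum_inl_mem_hyperpathEdgeFinset]
      show _ = lam * r p ^ k
      rw [hr]
      have hpm := hrec p (by omega)
      obtain ⟨p, hp⟩ := p
      have h1 : μ * padSeq X p = z p * if p = 0 then 0 else z (p - 1) := by
        rcases p with _ | q
        · simp [padSeq]
        · rw [padSeq_succ_of_lt X (by omega : q < m)]
          simp [X]
          field_simp
      have h2 : μ * padSeq X (p + 1) = z p * if p = m then 0 else z (p + 1) := by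
        by_cases hpm : p = m
        · rw [padSeq_of_lt X (by omega)]
          simp [hpm]
        · rw [padSeq_succ_of_lt X (by omega : p < m)]
          simp [X, hpm]
          field_simp
      apply mul_left_cancel₀ hμ0
      rw [mul_add, h1, h2, ← mul_add, ← hpm]
      field_simp
    · rw [sum_inr_mem_hyperpathEdgeFinset]
      show _ = lam * g e a ^ k
      rw [hg]
      field_simp

/-- For a vector supported at one vertex, every edge has `k - 1 ≥ 2` zeros, so one survives the
erasure of `v`. -/
theorem hyperpath_isEigenvalue_zero (hk : 3 ≤ k) :
    ((hyperpath k m).adjTensor k).IsEigenvalue 0 := by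
  rw [hyperpath_isEigenvalue_iff (by omega)]
  refine ⟨Pi.single (Sum.inl 0) 1, ?_, fun v => ?_⟩
  · intro h
    simpa using congrFun h (Sum.inl 0)
  rw [zero_mul]
  refine Finset.sum_eq_zero fun i _ => ?_
  by_cases hv : v = Sum.inl i.succ
  · refine Finset.prod_eq_zero (i := Sum.inr (i, ⟨0, by omega⟩)) ?_ (by simp)
    simp [hv, inr_mem_hyperpathEdgeFinset]
  · refine Finset.prod_eq_zero (i := Sum.inl i.succ) ?_ (by simp)
    simp [inl_mem_hyperpathEdgeFinset, Ne.symm hv]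

/-- The positive eigenvector of a path. -/
theorem hyperpath_two_isEigenvalue (m : ℕ) :
    ((hyperpath 2 m).adjTensor 2).IsEigenvalue
      ((2 * Real.cos (Real.pi / (m + 2)) : ℝ) : ℂ) := by
  rw [hyperpath_isEigenvalue_iff le_rfl]
  let s : ℕ → ℝ := fun i => Real.sin ((i : ℝ) * (Real.pi / (m + 2)))
  have hspos : ∀ p : Fin (m + 1), 0 < s (p + 1) := by
    intro p
    have hp : ((p : ℕ) : ℝ) + 1 < m + 2 := by
      have := p.2
      exact_mod_cast (by omega : (p : ℕ) + 1 < m + 2)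
    apply Real.sin_pos_of_pos_of_lt_pi
    · push_cast; positivity
    · push_cast
      rw [← mul_div_assoc, div_lt_iff₀ (by positivity), mul_comm]
      gcongr
  have hrec : ∀ i : ℕ, s i + s (i + 2) = 2 * Real.cos (Real.pi / (m + 2)) * s (i + 1) := by
    intro i
    simp only [s]
    push_cast
    generalize Real.pi / ((m : ℝ) + 2) = c
    rw [show (i : ℝ) * c = (i + 1) * c - c by ring,
      show ((i : ℝ) + 2) * c = (i + 1) * c + c by ring, Real.sin_sub, Real.sin_add]
    ring
  have hs0 : s 0 = 0 := by simp [s]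
  have hsm : s (m + 2) = 0 := by
    simp only [s]
    push_cast
    rw [mul_div_cancel₀ _ (by positivity), Real.sin_pi]
  let y : HyperpathVertex 2 m → ℂ := Sum.elim (fun p => (s (p + 1) : ℂ)) fun _ => 0
  have hX : ∀ i, ∏ w ∈ hyperpathEdgeFinset 2 m i, y w = (s (i + 1) * s (i + 2) : ℂ) := by
    intro i
    rw [prod_hyperpathEdgeFinset]
    simp [y]
  have hy : ∀ p, y (Sum.inl p) ≠ 0 := fun p => Complex.ofReal_ne_zero.mpr (hspos p).ne'
  refine ⟨y, fun h => hy 0 (congrFun h _), fun v => ?_⟩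
  rcases v with p | ⟨_, a⟩
  · apply mul_left_cancel₀ (hy p)
    rw [mul_sum_prod_erase, Finset.sum_congr rfl fun i _ => hX i,
      sum_inl_mem_hyperpathEdgeFinset]
    have h1 : padSeq (fun i : Fin m => (s (i + 1) * s (i + 2) : ℂ)) p = s p * s (p + 1) := by
      obtain ⟨p, hp⟩ := p
      rcases p with _ | q
      · simp [padSeq, hs0]
      · simp only []
        rw [padSeq_succ_of_lt _ (by omega : q < m)]
    have h2 : padSeq (fun i : Fin m => (s (i + 1) * s (i + 2) : ℂ)) (p + 1) =
        s (p + 1) * s (p + 2) := by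
      by_cases hp : (p : ℕ) < m
      · rw [padSeq_succ_of_lt _ hp]
      · have hpm : (p : ℕ) = m := by omega
        rw [padSeq_of_lt _ (by omega), hpm, hsm]
        simp
    rw [h1, h2]
    have h3 : (s p : ℂ) + s (p + 2) = ((2 * Real.cos (Real.pi / (m + 2)) : ℝ) : ℂ) * s (p + 1) := by
      rw [← Complex.ofReal_mul, ← hrec p, Complex.ofReal_add]
    show _ = (s (p + 1) : ℂ) * (_ * (s (p + 1) : ℂ) ^ 1)
    linear_combination (s (p + 1) : ℂ) * h3
  · exact a.elim0

end

/-! ### Complex powers, roots of unity and bounds on cosines -/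

section

variable {k m : ℕ}

theorem cpow_two_div_pow (hk : 2 ≤ k) (μ : ℂ) : (μ ^ ((2 : ℂ) / k)) ^ k = μ ^ 2 := by
  have hk0 : (k : ℂ) ≠ 0 := by exact_mod_cast (by omega : k ≠ 0)
  rw [← Complex.cpow_mul_nat, div_mul_cancel₀ _ hk0]
  exact_mod_cast Complex.cpow_natCast μ 2

theorem exp_two_pi_mul_div_pow (hk : 2 ≤ k) (θ : ℕ) :
    Complex.exp (2 * Real.pi * Complex.I * θ / k) ^ k = 1 := by
  have hk0 : (k : ℂ) ≠ 0 := by exact_mod_cast (by omega : k ≠ 0)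
  rw [← Complex.exp_nat_mul, Complex.exp_eq_one_iff]
  exact ⟨θ, by push_cast; field_simp⟩

theorem exists_eq_cpow_mul_exp (hk : 2 ≤ k) {lam μ : ℂ} (hlam : lam ≠ 0)
    (h : lam ^ k = μ ^ 2) : ∃ θ ∈ Finset.Icc 1 k,
      lam = μ ^ ((2 : ℂ) / k) * Complex.exp (2 * Real.pi * Complex.I * θ / k) := by
  have hk0 : k ≠ 0 := by omega
  have : NeZero k := ⟨hk0⟩
  have hkc : (k : ℂ) ≠ 0 := by exact_mod_cast hk0
  have hpow := cpow_two_div_pow hk μ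
  have hr0 : μ ^ ((2 : ℂ) / k) ≠ 0 := by
    intro h0
    rw [h0, zero_pow hk0, ← h] at hpow
    exact pow_ne_zero k hlam hpow.symm
  have h1 : (lam / μ ^ ((2 : ℂ) / k)) ^ k = 1 := by
    rw [div_pow, hpow, h]
    exact div_self (h ▸ pow_ne_zero k hlam)
  obtain ⟨i, hi, hi'⟩ := (Complex.isPrimitiveRoot_exp k hk0).eq_pow_of_pow_eq_one h1
  have h2 : lam = μ ^ ((2 : ℂ) / k) * Complex.exp (2 * Real.pi * Complex.I / k) ^ i := by
    rw [hi']
    field_simp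
  -- Exponents run over `0, …, k - 1` but `θ` over `1, …, k`, so `0` becomes `k`.
  rcases Nat.eq_zero_or_pos i with rfl | hpos
  · refine ⟨k, Finset.mem_Icc.mpr ⟨by omega, le_rfl⟩, ?_⟩
    rw [mul_div_cancel_right₀ _ hkc, Complex.exp_two_pi_mul_I]
    simpa using h2
  · refine ⟨i, Finset.mem_Icc.mpr ⟨hpos, hi.le⟩, ?_⟩
    rw [h2, ← Complex.exp_nat_mul]
    congr 2
    ring

theorem mem_hyperpathNumbers_of_isEigenvalue (hk : 2 ≤ k) {lam : ℂ} (hlam : lam ≠ 0)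
    (h : ((hyperpath k m).adjTensor k).IsEigenvalue lam) : lam ∈ hyperpathNumbers k m := by
  obtain ⟨j, hj, t, ht, h⟩ := pow_eq_sq_of_hyperpath_isEigenvalue hk hlam h
  obtain ⟨θ, hθ, h⟩ := exists_eq_cpow_mul_exp hk hlam h
  exact ⟨j, hj, t, ht, θ, hθ, h⟩

theorem isEigenvalue_of_mem_hyperpathNumbers (hk : 3 ≤ k) {lam : ℂ}
    (h : lam ∈ hyperpathNumbers k m) : ((hyperpath k m).adjTensor k).IsEigenvalue lam := by
  by_cases hlam : lam = 0
  · rw [hlam]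
    exact hyperpath_isEigenvalue_zero hk
  obtain ⟨j, hj, t, ht, θ, hθ, h⟩ := h
  rw [Finset.mem_Icc] at hj ht
  have hpow : lam ^ k = ((2 * Real.cos (Real.pi * t / (j + 2)) : ℝ) : ℂ) ^ 2 := by
    rw [h, mul_pow, cpow_two_div_pow (by omega), exp_two_pi_mul_div_pow (by omega), mul_one]
  let c : ℝ := Real.pi * t / (j + 2)
  let s : ℕ → ℝ := fun i => Real.sin ((i : ℝ) * c)
  have hrec : ∀ i : ℕ, s i + s (i + 2) = 2 * Real.cos c * s (i + 1) := by
    intro i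
    simp only [s]
    push_cast
    rw [show (i : ℝ) * c = (i + 1) * c - c by ring,
      show ((i : ℝ) + 2) * c = (i + 1) * c + c by ring, Real.sin_sub, Real.sin_add]
    ring
  have hs0 : s 0 = 0 := by simp [s]
  have hsj : s (j + 2) = 0 := by
    simp only [s, c]
    push_cast
    rw [mul_div_cancel₀ _ (by positivity), mul_comm, Real.sin_nat_mul_pi]
  have hs1 : s 1 ≠ 0 := by
    apply ne_of_gt
    simp only [s, c, Nat.cast_one, one_mul]
    have ht1 : (0 : ℝ) < t := by exact_mod_cast (by omega : 0 < t)
    have ht2 : (t : ℝ) < j + 2 := by exact_mod_cast (by omega : t < j + 2)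
    apply Real.sin_pos_of_pos_of_lt_pi
    · positivity
    · rw [div_lt_iff₀ (by positivity)]
      gcongr
  refine hyperpath_isEigenvalue_of_pow_eq_sq hk hlam hpow
    (z := fun i => if i ≤ j then (s (i + 1) : ℂ) else 0) ⟨0, by omega, ?_⟩ ?_
  · simpa using hs1
  · intro i him
    by_cases hij : i ≤ j
    · have h1 : (if i = 0 then (0 : ℂ) else if i - 1 ≤ j then (s (i - 1 + 1) : ℂ) else 0) =
          s i := by
        rcases i with _ | i
        · simp [hs0]
        · simp [show i ≤ j by omega]
      have h2 : (if i = m then (0 : ℂ) else if i + 1 ≤ j then (s (i + 1 + 1) : ℂ) else 0) =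
          s (i + 2) := by
        by_cases hj' : i = j
        · subst hj'
          simp [hsj]
        · rw [if_neg (by omega), if_pos (by omega)]
      have h3 : (s i : ℂ) + s (i + 2) = ((2 * Real.cos c : ℝ) : ℂ) * s (i + 1) := by
        rw [← Complex.ofReal_mul, ← hrec, Complex.ofReal_add]
      simp only [h1, h2, h3, if_pos hij, c]
    · simp [hij]

theorem zero_mem_hyperpathNumbers (hk : 2 ≤ k) (hm : 2 ≤ m) :
    (0 : ℂ) ∈ hyperpathNumbers k m := by
  have hk0 : (k : ℂ) ≠ 0 := by exact_mod_cast (by omega : k ≠ 0)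
  refine ⟨2, by simp [hm], 2, by simp, 1, by simp; omega, ?_⟩
  rw [show Real.pi * (2 : ℕ) / ((2 : ℕ) + 2) = Real.pi / 2 by push_cast; ring, Real.cos_pi_div_two]
  simp [hk0]

theorem norm_cpow_two_div_mul_exp (x : ℝ) (k θ : ℕ) :
    ‖(x : ℂ) ^ ((2 : ℂ) / k) * Complex.exp (2 * Real.pi * Complex.I * θ / k)‖ =
      |x| ^ ((2 : ℝ) / k) := by
  rw [norm_mul, show (2 : ℂ) / k = ((2 / k : ℝ) : ℂ) by push_cast; rfl, Complex.norm_cpow_real,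
    show 2 * Real.pi * Complex.I * θ / k = ((2 * Real.pi * θ / k : ℝ) : ℂ) * Complex.I by
      push_cast; ring,
    Complex.norm_exp_ofReal_mul_I, mul_one, Complex.norm_real, Real.norm_eq_abs]

theorem pi_div_add_two_le_pi_div_two (m : ℕ) : Real.pi / (m + 2) ≤ Real.pi / 2 := by
  have := Real.pi_pos
  gcongr
  simp

theorem cos_pi_div_add_two_nonneg (m : ℕ) : 0 ≤ Real.cos (Real.pi / (m + 2)) :=
  Real.cos_nonneg_of_mem_Icc
    ⟨(neg_nonpos.mpr (by positivity)).trans (by positivity), pi_div_add_two_le_pi_div_two m⟩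

/-- Both the angle and its supplement are at least `π / (j + 2) ≥ π / (m + 2)`, and cosine decreases
on `[0, π]`. -/
theorem abs_cos_le_cos_pi_div {j m t : ℕ} (hj : j ≤ m) (ht : 1 ≤ t) (ht' : t ≤ j + 1) :
    |Real.cos (Real.pi * t / (j + 2))| ≤ Real.cos (Real.pi / (m + 2)) := by
  have hπ := Real.pi_pos
  have h0 : (1 : ℝ) ≤ t := by exact_mod_cast ht
  have h1 : (t : ℝ) ≤ j + 1 := by exact_mod_cast ht'
  have hjm : Real.pi / (m + 2) ≤ Real.pi / (j + 2) := by gcongr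
  have hle : Real.pi / (j + 2) ≤ Real.pi * t / (j + 2) := by
    gcongr
    nlinarith
  have hge : Real.pi / (j + 2) ≤ Real.pi - Real.pi * t / (j + 2) := by
    rw [le_sub_iff_add_le, ← add_div, div_le_iff₀ (by positivity)]
    nlinarith
  have hpos : 0 ≤ Real.pi / (m + 2 : ℝ) := by positivity
  rw [abs_le]
  constructor
  · rw [neg_le, ← Real.cos_pi_sub]
    apply Real.cos_le_cos_of_nonneg_of_le_pi hpos _ (hjm.trans hge)
    linarith [hle, show 0 ≤ Real.pi / (j + 2 : ℝ) by positivity]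
  · apply Real.cos_le_cos_of_nonneg_of_le_pi hpos _ (hjm.trans hle)
    linarith [hge, show 0 ≤ Real.pi / (j + 2 : ℝ) by positivity]

theorem norm_le_of_mem_hyperpathNumbers {lam : ℂ} (h : lam ∈ hyperpathNumbers k m) :
    ‖lam‖ ≤ (2 * Real.cos (Real.pi / (m + 2))) ^ ((2 : ℝ) / k) := by
  obtain ⟨j, hj, t, ht, θ, -, rfl⟩ := h
  rw [Finset.mem_Icc] at hj ht
  rw [norm_cpow_two_div_mul_exp, abs_mul, abs_two]
  gcongr
  exact abs_cos_le_cos_pi_div hj.2 ht.1 ht.2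

end

theorem mainTheorem3 (k m : ℕ) (hk : 2 ≤ k) (hm : 1 ≤ m) :
    (3 ≤ k → ((hyperpath k m).adjTensor k).eigenvalues = insert 0 (hyperpathNumbers k m)) ∧
    (3 ≤ k → 2 ≤ m → ((hyperpath k m).adjTensor k).eigenvalues = hyperpathNumbers k m) ∧
    ((hyperpath k m).adjTensor k).IsSpectralRadius
      ((2 * Real.cos (Real.pi / (m + 2))) ^ ((2 : ℝ) / k)) := by
  have hall : 3 ≤ k →
      ((hyperpath k m).adjTensor k).eigenvalues = insert 0 (hyperpathNumbers k m) := by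
    intro hk3
    ext lam
    constructor
    · intro h
      by_cases h0 : lam = 0
      · exact Or.inl h0
      · exact Or.inr (mem_hyperpathNumbers_of_isEigenvalue hk h0 h)
    · rintro (rfl | h)
      · exact hyperpath_isEigenvalue_zero hk3
      · exact isEigenvalue_of_mem_hyperpathNumbers hk3 h
  have hcos := cos_pi_div_add_two_nonneg m
  refine ⟨hall, fun hk3 hm2 => ?_, ?_, ?_⟩
  · rw [hall hk3, Set.insert_eq_of_mem (zero_mem_hyperpathNumbers hk hm2)]
  -- For `k = 2` the numbers with `j < m` need not be eigenvalues, so the extremal one is exhibited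
  -- directly.
  · rcases hk.eq_or_lt with rfl | hk3
    · refine ⟨_, hyperpath_two_isEigenvalue m, ?_⟩
      rw [Complex.norm_real, Real.norm_of_nonneg (by positivity)]
      simp
    · have hmem : _ ∈ hyperpathNumbers k m :=
        ⟨m, Finset.mem_Icc.mpr ⟨hm, le_rfl⟩, 1, by simp, 1, Finset.mem_Icc.mpr ⟨le_rfl, by omega⟩,
          rfl⟩
      refine ⟨_, isEigenvalue_of_mem_hyperpathNumbers hk3 hmem, ?_⟩
      rw [norm_cpow_two_div_mul_exp, Nat.cast_one, mul_one, abs_of_nonneg (by positivity)]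
  · rintro _ ⟨lam, h, rfl⟩
    by_cases h0 : lam = 0
    · rw [h0, norm_zero]
      positivity
    · exact norm_le_of_mem_hyperpathNumbers (mem_hyperpathNumbers_of_isEigenvalue hk h0 h)
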